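/- Let $d\ge 1$, $Q=[-1,1]^d$ and, for $0<\delta<1$, $Q_\delta=[-1+\delta,1-\delta]^d$. For every $\alpha>0$ there is a constant $C>0$, depending only on $d$ and $\alpha$, such that for every continuous $f:Q\to\mathbb{R}$, every integer $N\ge 1$ and every $0<\delta<1$ there is a function $\tilde f:\mathbb{R}^d\to\mathbb{R}$ with $\tilde f=0$ outside $Q$ (so $\operatorname{supp}\tilde f=\{\tilde f\neq 0\}\subseteq Q$) that is implemented by a classical feedforward ReLU network of width at most $C\max\{N^3,N^{d-1}\log N\}$ and depth at most $C(1+\log N)$ (which is $O(\log N)$ for $N\ge2$) and satisfies $$\sup_{x\in Q_\delta}|\tilde f(x)-f(x)|\le C\left(\tilde\omega_Q\left(f,\tfrac1N\right)+N^{-\alpha}\right).$$ Here the depth of a network is its number of hidden layers and its width is the largest number of neurons in a hidden layer; $\tilde\omega_Q$ is the Totik–Ditzian modulus of continuity $$\tilde\omega_Q(f,t)=\sup\left|f\left(x+\tfrac{h\,\tilde d_Q(e,x)}{2}e\right)-f\left(x-\tfrac{h\,\tilde d_Q(e,x)}{2}e\right)\right|,$$ the supremum being taken over all $x\in Q$,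 all unit vectors $e$ parallel to an edge of $Q$ and all $0<h\le t$ for which both arguments of $f$ lie in $Q$; and $\tilde d_Q(e,x)=\sqrt{|x-a|\,|x-b|}$, where $a,b$ are the endpoints of the segment in which the line through $x$ parallel to $e$ meets $Q$. -/

import Mathlib

/-- The cube `Q = [-1,1]^d` in Euclidean space. -/
def cube (d : ℕ) : Set (EuclideanSpace ℝ (Fin d)) :=
  {x | ∀ i, x i ∈ Set.Icc (-1 : ℝ) 1}

/-- The smaller cube `Q_δ = [-1+δ,1-δ]^d`. -/
def shrunkCube (d : ℕ) (δ : ℝ) : Set (EuclideanSpace ℝ (Fin d)) :=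
  {x | ∀ i, x i ∈ Set.Icc (-1 + δ) (1 - δ)}

/-- The unit vectors parallel to an edge of the polytope `K`. An edge is a one-dimensional face,
that is, a nondegenerate segment that is an extreme subset of `K`. -/
def edgeDirections {d : ℕ} (K : Set (EuclideanSpace ℝ (Fin d))) :
    Set (EuclideanSpace ℝ (Fin d)) :=
  {e | ∃ a b : EuclideanSpace ℝ (Fin d), a ≠ b ∧ IsExtreme ℝ K (segment ℝ a b) ∧
    e = ‖b - a‖⁻¹ • (b - a)}

/-- For a unit vector `e` and a point `x` of a compact convex set `K`: the distance from `x` to the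
endpoint, in direction `e`, of the chord of `K` through `x` parallel to `e`. -/
noncomputable def distToEndpoint {d : ℕ} (K : Set (EuclideanSpace ℝ (Fin d)))
    (e x : EuclideanSpace ℝ (Fin d)) : ℝ :=
  sSup {s : ℝ | 0 ≤ s ∧ x + s • e ∈ K}

/-- The normalized distance: the geometric mean of the distances from `x` to the two endpoints of
the chord of `K` through `x` parallel to `e`. -/
noncomputable def normalizedDist {d : ℕ} (K : Set (EuclideanSpace ℝ (Fin d)))
    (e x : EuclideanSpace ℝ (Fin d)) : ℝ :=
  Real.sqrt (distToEndpoint K e x * distToEndpoint K (-e) x)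

/-- The Totik-Ditzian modulus of continuity of `f` on `K`. As usual, only those symmetric
differences count whose two nodes both lie in `K`, where `f` is given. -/
noncomputable def totikDitzianModulus {d : ℕ} (K : Set (EuclideanSpace ℝ (Fin d)))
    (f : EuclideanSpace ℝ (Fin d) → ℝ) (t : ℝ) : ℝ :=
  sSup {r : ℝ | ∃ x ∈ K, ∃ e ∈ edgeDirections K, ∃ h : ℝ, 0 < h ∧ h ≤ t ∧
    x + (h * normalizedDist K e x / 2) • e ∈ K ∧
    x - (h * normalizedDist K e x / 2) • e ∈ K ∧
    r = |f (x + (h * normalizedDist K e x / 2) • e) -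
         f (x - (h * normalizedDist K e x / 2) • e)|}

/-- A classical (feedforward, fully connected) ReLU network with `n` inputs and one real output:
either the final affine map, or a hidden layer of `m` neurons `y ↦ σ (W y + b)` followed by a
network with `m` inputs. -/
inductive ReLUNetwork : ℕ → Type
  | output {n : ℕ} (w : Fin n → ℝ) (b : ℝ) : ReLUNetwork n
  | hidden {n m : ℕ} (W : Matrix (Fin m) (Fin n) ℝ) (b : Fin m → ℝ) (rest : ReLUNetwork m) :
      ReLUNetwork n

/-- The function computed by a network, with activation `σ t = max 0 t`. -/
noncomputable def ReLUNetwork.eval : {n : ℕ} → ReLUNetwork n → (Fin n → ℝ) → ℝ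
  | _, .output w b, y => (∑ i, w i * y i) + b
  | _, .hidden W b rest, y => rest.eval (fun j => max 0 ((∑ i, W j i * y i) + b j))

/-- The depth: the number of hidden layers. -/
def ReLUNetwork.depth : {n : ℕ} → ReLUNetwork n → ℕ
  | _, .output _ _ => 0
  | _, .hidden _ _ rest => rest.depth + 1

/-- The width: the largest number of neurons in a hidden layer. -/
def ReLUNetwork.width : {n : ℕ} → ReLUNetwork n → ℕ
  | _, .output _ _ => 0
  | _, .hidden (m := m) _ _ rest => max m rest.width

/-- The function on Euclidean space implemented by a network. -/
noncomputable def ReLUNetwork.toFun {d : ℕ} (φ : ReLUNetwork d)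
    (x : EuclideanSpace ℝ (Fin d)) : ℝ :=
  φ.eval (fun i => x i)

/-! In the angle variables `x i = -cos (θ i)` the Totik–Ditzian modulus at `t` controls the change
of `f` when one angle moves by at most `t` (`cos_sub_cos_le_mul_sqrt`,
`abs_sub_chebyshevPoint_update_le`). It therefore suffices to approximate `f` up to boundedly many
steps of size `1/N` in each angle, so a Chebyshev grid with `M = 2 ^ m` cells per axis, `N ≤ M ≤
2N`, is fine enough.

The last `d - 1` coordinates are split into `M ^ (d - 1)` cells. For each cell, `f + B ≥ 0` (where
`|f| ≤ B` on the cube) is interpolated linearly in the first coordinate, along the lowest corner of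
the cell, and a steep multiple of the distance to the cell is subtracted. At a given point the far
cells become nonpositive, the near ones exceed `f + B` by at most the allowed error, and the cell
containing the point has no penalty. Hence the maximum over all cells approximates `f + B`
(`cellMax_approx`).

A binary tree computes this maximum with `O(M ^ (d - 1))` neurons per layer and `O(log M)` layers
(`realizesNonneg_maxTree`). A last layer truncates the result to `[-t, t]`, where `t` equals `B` on
the smaller cube and `0` outside the cube. This gives the support condition and changes nothing on
the smaller cube. The resulting error is a multiple of the modulus alone. -/

/-! ### Composition of layers -/

/-- `g` agrees on nonnegative inputs with a network of width at most `w` and depth at most `l`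
(with inputs indexed by `ι`). -/
def RealizesNonneg {ι : Type} (w l : ℕ) (g : (ι → ℝ) → ℝ) : Prop :=
  ∀ (n : ℕ) (e : ι ≃ Fin n), ∃ φ : ReLUNetwork n, φ.width ≤ w ∧ φ.depth ≤ l ∧
    ∀ y : ι → ℝ, (∀ i, 0 ≤ y i) → φ.eval (fun k => y (e.symm k)) = g y

/-- Affine functions of finitely many real variables. -/
def IsAffineFun {ι : Type} [Fintype ι] (h : (ι → ℝ) → ℝ) : Prop :=
  ∃ (w : ι → ℝ) (b : ℝ), ∀ y, h y = (∑ i, w i * y i) + b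

namespace IsAffineFun

variable {ι : Type} [Fintype ι]

lemma const (c : ℝ) : IsAffineFun (fun _ : ι → ℝ => c) := ⟨0, c, by simp⟩

lemma coord (i : ι) : IsAffineFun (fun y : ι → ℝ => y i) := by
  classical
  exact ⟨Pi.single i 1, 0, fun y => by simp [Pi.single_apply]⟩

lemma add {g h : (ι → ℝ) → ℝ} (hg : IsAffineFun g) (hh : IsAffineFun h) :
    IsAffineFun (fun y => g y + h y) := by
  obtain ⟨w, b, hw⟩ := hg
  obtain ⟨v, c, hv⟩ := hh
  refine ⟨fun i => w i + v i, b + c, fun y => ?_⟩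
  simp only [hw, hv, add_mul, Finset.sum_add_distrib]
  ring

lemma const_mul {g : (ι → ℝ) → ℝ} (a : ℝ) (hg : IsAffineFun g) :
    IsAffineFun (fun y => a * g y) := by
  obtain ⟨w, b, hw⟩ := hg
  refine ⟨fun i => a * w i, a * b, fun y => ?_⟩
  simp only [hw, mul_add, Finset.mul_sum, mul_assoc]

lemma sub {g h : (ι → ℝ) → ℝ} (hg : IsAffineFun g) (hh : IsAffineFun h) :
    IsAffineFun (fun y => g y - h y) := by
  simpa [sub_eq_add_neg] using hg.add (hh.const_mul (-1))

lemma sum {κ : Type} (s : Finset κ) {g : κ → (ι → ℝ) → ℝ} (hg : ∀ k, IsAffineFun (g k)) :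
    IsAffineFun (fun y => ∑ k ∈ s, g k y) := by
  classical
  induction s using Finset.induction_on with
  | empty => simpa using const 0
  | insert a s ha ih => simpa [Finset.sum_insert ha] using (hg a).add ih

end IsAffineFun

lemma IsAffineFun.realizesNonneg {ι : Type} [Fintype ι] {h : (ι → ℝ) → ℝ} (hh : IsAffineFun h) :
    RealizesNonneg 0 0 h := by
  obtain ⟨w, b, hw⟩ := hh
  intro n e
  refine ⟨.output (fun k => w (e.symm k)) b, le_rfl, le_rfl, fun y _ => ?_⟩
  rw [hw, ReLUNetwork.eval]
  congr 1
  exact Equiv.sum_comp e.symm fun i => w i * y i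

/-- The outputs of a ReLU layer are nonnegative, so what follows it need only be correct there. No
sign condition is put on `y`, so this form also serves the first layer, which reads the raw
coordinates. -/
lemma RealizesNonneg.exists_hidden {ι κ : Type} [Fintype ι] [Fintype κ] {w l : ℕ}
    {g : (κ → ℝ) → ℝ} (hg : RealizesNonneg w l g) (hw : Fintype.card κ ≤ w)
    {H : κ → (ι → ℝ) → ℝ} (hH : ∀ k, IsAffineFun (H k)) {n : ℕ} (e : ι ≃ Fin n) :
    ∃ φ : ReLUNetwork n, φ.width ≤ w ∧ φ.depth ≤ l + 1 ∧
      ∀ y : ι → ℝ, φ.eval (fun k => y (e.symm k)) = g (fun k => max 0 (H k y)) := by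
  choose W b hW using hH
  obtain ⟨φ, h1, h2, h3⟩ := hg _ (Fintype.equivFin κ)
  refine ⟨.hidden (Matrix.of fun j k => W ((Fintype.equivFin κ).symm j) (e.symm k))
    (fun j => b ((Fintype.equivFin κ).symm j)) φ, max_le hw h1, Nat.succ_le_succ h2,
    fun y => ?_⟩
  rw [ReLUNetwork.eval, ← h3 _ fun k => le_max_left _ _]
  congr 1
  funext j
  simp only [hW, Matrix.of_apply]
  congr 2
  exact Equiv.sum_comp e.symm fun i => W ((Fintype.equivFin κ).symm j) i * y i

lemma RealizesNonneg.hidden {ι κ : Type} [Fintype ι] [Fintype κ] {w l : ℕ}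
    {g : (κ → ℝ) → ℝ} (hg : RealizesNonneg w l g) (hw : Fintype.card κ ≤ w)
    {H : κ → (ι → ℝ) → ℝ} (hH : ∀ k, IsAffineFun (H k)) :
    RealizesNonneg w (l + 1) (fun y => g (fun k => max 0 (H k y))) := by
  intro n e
  obtain ⟨φ, h1, h2, h3⟩ := hg.exists_hidden hw hH e
  exact ⟨φ, h1, h2, fun y _ => h3 y⟩

lemma RealizesNonneg.mono {ι : Type} {w w' l l' : ℕ} {g g' : (ι → ℝ) → ℝ}
    (hg : RealizesNonneg w l g) (hw : w ≤ w') (hl : l ≤ l')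
    (h : ∀ y : ι → ℝ, (∀ i, 0 ≤ y i) → g' y = g y) : RealizesNonneg w' l' g' := by
  intro n e
  obtain ⟨φ, h1, h2, h3⟩ := hg n e
  exact ⟨φ, h1.trans hw, h2.trans hl, fun y hy => (h3 y hy).trans (h y hy).symm⟩

/-! ### Truncation and the maximum tree -/

/-- For `0 ≤ t` this is the truncation of `v` to `[-t, t]`. -/
noncomputable def truncate (v t : ℝ) : ℝ := max 0 (v + t) - max 0 (v - t) - t

lemma truncate_zero (v : ℝ) : truncate v 0 = 0 := by simp [truncate]

lemma truncate_of_abs_le {v t : ℝ} (h : |v| ≤ t) : truncate v t = v := by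
  obtain ⟨h1, h2⟩ := abs_le.1 h
  rw [truncate, max_eq_right (by linarith), max_eq_left (by linarith)]
  ring

/-- Activations of the maximum tree: two neurons per remaining candidate, whose sum is the
candidate value, and one neuron that carries the truncation level. -/
abbrev MaxTreeIndex (k : ℕ) : Type := ((Fin k → Bool) × Bool) ⊕ Unit

lemma iSup_fin_succ_bool {k : ℕ} (v : (Fin (k + 1) → Bool) → ℝ) :
    ⨆ p, v p = ⨆ p : Fin k → Bool, max (v (Fin.cons false p)) (v (Fin.cons true p)) := by
  apply le_antisymm
  · refine ciSup_le fun p => ?_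
    refine le_ciSup_of_le (Finite.bddAbove_range _) (Fin.tail p) ?_
    rcases hb : p 0 with _ | _
    · refine le_max_of_le_left (le_of_eq ?_)
      rw [← hb, Fin.cons_self_tail]
    · refine le_max_of_le_right (le_of_eq ?_)
      rw [← hb, Fin.cons_self_tail]
  · exact ciSup_le fun p => max_le (le_ciSup (f := v) (Finite.bddAbove_range _) _)
      (le_ciSup (f := v) (Finite.bddAbove_range _) _)

/-- Each layer halves the candidates through `max a b = max 0 (a - b) + max 0 b`, valid for `b ≥ 0`;
the nonnegative level passes through a ReLU unchanged. The final layer adds `c` and truncates with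
three neurons. -/
lemma realizesNonneg_maxTree (c : ℝ) (k : ℕ) :
    RealizesNonneg (2 ^ (k + 1) + 1) (k + 1) (fun y : MaxTreeIndex k → ℝ =>
      truncate (c + ⨆ p : Fin k → Bool, (y (.inl (p, false)) + y (.inl (p, true))))
        (y (.inr ()))) := by
  induction k with
  | zero =>
    have hout : IsAffineFun (fun z : Fin 3 → ℝ => z 0 - z 1 - z 2) :=
      ((IsAffineFun.coord 0).sub (.coord 1)).sub (.coord 2)
    let v : (MaxTreeIndex 0 → ℝ) → ℝ := fun y =>
      c + (y (.inl (fun _ => false, false)) + y (.inl (fun _ => false, true)))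
    have hv : IsAffineFun v := (IsAffineFun.const c).add ((IsAffineFun.coord _).add (.coord _))
    have ht : IsAffineFun (fun y : MaxTreeIndex 0 → ℝ => y (.inr ())) := .coord _
    have h3 := (hout.realizesNonneg.mono (w' := 3) (l' := 0) (by simp) le_rfl
      fun y _ => rfl).hidden (by simp)
      (H := ![fun y => v y + y (.inr ()), fun y => v y - y (.inr ()), fun y => y (.inr ())])
      (fun i => by
        fin_cases i
        · exact hv.add ht
        · exact hv.sub ht
        · exact ht)
    refine h3.mono (by norm_num) le_rfl fun y hy => ?_
    have hs (g : (Fin 0 → Bool) → ℝ) : ⨆ p, g p = g fun _ => false := by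
      rw [ciSup_unique]
      exact congrArg g (Subsingleton.elim _ _)
    simp only [hs]
    simp [truncate, v, hy]
  | succ k ih =>
    let H : MaxTreeIndex k → (MaxTreeIndex (k + 1) → ℝ) → ℝ := fun i y =>
      match i with
      | .inl (p, false) =>
        (y (.inl (Fin.cons false p, false)) + y (.inl (Fin.cons false p, true))) -
        (y (.inl (Fin.cons true p, false)) + y (.inl (Fin.cons true p, true)))
      | .inl (p, true) => y (.inl (Fin.cons true p, false)) + y (.inl (Fin.cons true p, true))
      | .inr () => y (.inr ())
    have hH : ∀ i, IsAffineFun (H i) := by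
      rintro (⟨p, _ | _⟩ | _)
      · exact ((IsAffineFun.coord _).add (.coord _)).sub ((IsAffineFun.coord _).add (.coord _))
      · exact (IsAffineFun.coord _).add (.coord _)
      · exact .coord _
    refine (ih.hidden ?_ hH).mono ?_ le_rfl fun y hy => ?_
    · simp [pow_succ]
    · simp only [add_le_add_iff_right]
      exact Nat.pow_le_pow_right (by norm_num) (by omega)
    · rw [iSup_fin_succ_bool]
      simp only [H, max_eq_right (hy _)]
      congr 3
      funext p
      have h0 := hy (.inl (Fin.cons true p, false))
      have h1 := hy (.inl (Fin.cons true p, true))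
      rw [max_eq_right (add_nonneg h0 h1), ← max_add_add_right]
      simp [max_comm]

/-! ### The modulus on the cube -/

lemma segment_cube_edge {d : ℕ} (l : Fin d) :
    segment ℝ (WithLp.toLp 2 (fun _ => -1) : EuclideanSpace ℝ (Fin d))
      (WithLp.toLp 2 (Function.update (fun _ => -1) l 1)) =
    {x | x ∈ cube d ∧ ∀ i, i ≠ l → x i = -1} := by
  ext x
  rw [segment_eq_image]
  constructor
  · rintro ⟨t, ⟨h0, h1⟩, rfl⟩
    have key : ∀ i, i ≠ l → ((1 - t) • (WithLp.toLp 2 (fun _ => -1) : EuclideanSpace ℝ (Fin d)) +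
        t • (WithLp.toLp 2 (Function.update (fun _ => -1) l 1) : EuclideanSpace ℝ (Fin d))) i =
          -1 := fun i hi => by
      simp only [PiLp.add_apply, PiLp.smul_apply, smul_eq_mul, Function.update_of_ne hi]
      ring
    refine ⟨fun i => ?_, key⟩
    by_cases hi : i = l
    · subst hi
      simp only [PiLp.add_apply, PiLp.smul_apply, smul_eq_mul, Function.update_self]
      constructor <;> linarith
    · rw [key i hi]
      constructor <;> norm_num
  · rintro ⟨hx, h⟩
    obtain ⟨h1, h2⟩ := hx l
    refine ⟨(x l + 1) / 2, ⟨by linarith, by linarith⟩, ?_⟩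
    ext i
    by_cases hi : i = l
    · subst hi
      simp only [PiLp.add_apply, PiLp.smul_apply, smul_eq_mul, Function.update_self]
      ring
    · simp only [PiLp.add_apply, PiLp.smul_apply, smul_eq_mul, Function.update_of_ne hi, h i hi]
      ring

lemma single_mem_edgeDirections_cube {d : ℕ} (l : Fin d) :
    EuclideanSpace.single l (1 : ℝ) ∈ edgeDirections (cube d) := by
  have hsub : (WithLp.toLp 2 (Function.update (fun _ => -1) l 1) : EuclideanSpace ℝ (Fin d)) -
      WithLp.toLp 2 (fun _ => -1) = (2 : ℝ) • EuclideanSpace.single l (1 : ℝ) := by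
    ext i
    by_cases hi : i = l
    · subst hi
      simp
      norm_num
    · simp [hi]
  refine ⟨WithLp.toLp 2 (fun _ => -1), WithLp.toLp 2 (Function.update (fun _ => -1) l 1),
    fun h => ?_, ?_, ?_⟩
  · have := congrArg (fun x : EuclideanSpace ℝ (Fin d) => x l) h
    simp at this
    norm_num at this
  · rw [segment_cube_edge]
    refine ⟨fun x hx => hx.1, fun x hx y hy z hz hzxy => ⟨hx, fun i hi => ?_⟩⟩
    obtain ⟨a, b, ha, hb, hab, rfl⟩ := hzxy
    have h1 := hz.2 i hi
    simp only [PiLp.add_apply, PiLp.smul_apply, smul_eq_mul] at h1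
    have hxi := (hx i).1
    have hyi := (hy i).1
    by_contra hne
    have hlt : -1 < x i := lt_of_le_of_ne hxi (Ne.symm hne)
    nlinarith [mul_pos ha (sub_pos.2 hlt), mul_nonneg hb.le (sub_nonneg.2 hyi)]
  · rw [hsub, norm_smul, smul_smul]
    simp

lemma mem_cube_of_forall_ne {d : ℕ} {x y : EuclideanSpace ℝ (Fin d)} (hx : x ∈ cube d) (l : Fin d)
    (h : ∀ i, i ≠ l → y i = x i) (hl : y l ∈ Set.Icc (-1 : ℝ) 1) : y ∈ cube d := by
  intro i
  by_cases hi : i = l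
  · exact hi ▸ hl
  · rw [h i hi]
    exact hx i

lemma distToEndpoint_cube_single {d : ℕ} (l : Fin d) {x : EuclideanSpace ℝ (Fin d)}
    (hx : x ∈ cube d) :
    distToEndpoint (cube d) (EuclideanSpace.single l (1 : ℝ)) x = 1 - x l := by
  have h := hx l
  apply IsGreatest.csSup_eq
  refine ⟨⟨by linarith [h.2], ?_⟩, fun s hs => ?_⟩
  · refine mem_cube_of_forall_ne hx l (fun i hi => by simp [hi]) ?_
    simp
  · have := (hs.2 l).2
    simp at this
    linarith

lemma distToEndpoint_cube_neg_single {d : ℕ} (l : Fin d) {x : EuclideanSpace ℝ (Fin d)}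
    (hx : x ∈ cube d) :
    distToEndpoint (cube d) (-EuclideanSpace.single l (1 : ℝ)) x = 1 + x l := by
  have h := hx l
  apply IsGreatest.csSup_eq
  refine ⟨⟨by linarith [h.1], ?_⟩, fun s hs => ?_⟩
  · refine mem_cube_of_forall_ne hx l (fun i hi => by simp [hi]) ?_
    simp
  · have := (hs.2 l).1
    simp at this
    linarith

lemma normalizedDist_cube_single {d : ℕ} (l : Fin d) {x : EuclideanSpace ℝ (Fin d)}
    (hx : x ∈ cube d) :
    normalizedDist (cube d) (EuclideanSpace.single l (1 : ℝ)) x =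
      Real.sqrt ((1 - x l) * (1 + x l)) := by
  rw [normalizedDist, distToEndpoint_cube_single l hx, distToEndpoint_cube_neg_single l hx]

lemma isCompact_cube (d : ℕ) : IsCompact (cube d) := by
  have h : cube d = (PiLp.homeomorph 2 (fun _ : Fin d => ℝ)) ⁻¹'
      (Set.univ.pi fun _ => Set.Icc (-1 : ℝ) 1) := by
    ext x
    simp [cube, PiLp.homeomorph, Pi.le_def, forall_and]
  rw [h, Homeomorph.isCompact_preimage]
  exact isCompact_univ_pi fun _ => isCompact_Icc

lemma exists_abs_le_of_continuousOn_cube {d : ℕ} {f : EuclideanSpace ℝ (Fin d) → ℝ}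
    (hf : ContinuousOn f (cube d)) : ∃ B : ℝ, 0 ≤ B ∧ ∀ x ∈ cube d, |f x| ≤ B := by
  obtain ⟨B, hB⟩ := (isCompact_cube d).exists_bound_of_continuousOn hf
  exact ⟨max B 0, le_max_right _ _, fun x hx => (hB x hx).trans (le_max_left _ _)⟩

lemma totikDitzianModulus_nonneg {d : ℕ} (K : Set (EuclideanSpace ℝ (Fin d)))
    (f : EuclideanSpace ℝ (Fin d) → ℝ) (t : ℝ) : 0 ≤ totikDitzianModulus K f t := by
  apply Real.sSup_nonneg
  rintro r ⟨x, -, e, -, h, -, -, -, -, rfl⟩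
  exact abs_nonneg _

/-- Compactness bounds the set of differences; without a bound `sSup` would take its default value
`0`. -/
lemma abs_sub_le_totikDitzianModulus {d : ℕ} {f : EuclideanSpace ℝ (Fin d) → ℝ}
    (hf : ContinuousOn f (cube d)) {t : ℝ} {x e : EuclideanSpace ℝ (Fin d)} {h : ℝ}
    (hx : x ∈ cube d) (he : e ∈ edgeDirections (cube d)) (h0 : 0 < h) (ht : h ≤ t)
    (h1 : x + (h * normalizedDist (cube d) e x / 2) • e ∈ cube d)
    (h2 : x - (h * normalizedDist (cube d) e x / 2) • e ∈ cube d) :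
    |f (x + (h * normalizedDist (cube d) e x / 2) • e) -
      f (x - (h * normalizedDist (cube d) e x / 2) • e)| ≤ totikDitzianModulus (cube d) f t := by
  obtain ⟨B, -, hB⟩ := exists_abs_le_of_continuousOn_cube hf
  refine le_csSup ⟨B + B, ?_⟩ ⟨x, hx, e, he, h, h0, ht, h1, h2, rfl⟩
  rintro r ⟨x, -, e, -, h, -, -, h1, h2, rfl⟩
  exact (abs_sub _ _).trans (add_le_add (hB _ h1) (hB _ h2))

/-! ### Passage to Chebyshev angles -/

/-- The point of the cube with coordinates `-cos (θ i)`. -/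
noncomputable def chebyshevPoint {d : ℕ} (θ : Fin d → ℝ) : EuclideanSpace ℝ (Fin d) :=
  WithLp.toLp 2 fun i => -Real.cos (θ i)

lemma chebyshevPoint_apply {d : ℕ} (θ : Fin d → ℝ) (i : Fin d) :
    chebyshevPoint θ i = -Real.cos (θ i) := rfl

lemma chebyshevPoint_mem_cube {d : ℕ} (θ : Fin d → ℝ) : chebyshevPoint θ ∈ cube d := fun i => by
  rw [chebyshevPoint_apply]
  exact ⟨neg_le_neg (Real.cos_le_one _), neg_le.1 (Real.neg_one_le_cos _)⟩

/-- With `s` the mean angle and `r` half the difference, the left side is `2 sin s sin r`, and the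
square root is `√(1 - cos² s cos² r) ≥ |sin s|`. The root is the normalized distance at the midpoint
of the two nodes. -/
lemma cos_sub_cos_le_mul_sqrt {a b t : ℝ} (hab : |b - a| ≤ t) :
    Real.cos a - Real.cos b ≤ t * Real.sqrt
      ((1 - (Real.cos a + Real.cos b) / 2) * (1 + (Real.cos a + Real.cos b) / 2)) := by
  set s := (a + b) / 2
  set r := (b - a) / 2
  have ha : a = s - r := by ring
  have hb : b = s + r := by ring
  have hm : (Real.cos a + Real.cos b) / 2 = Real.cos s * Real.cos r := by
    rw [ha, hb, Real.cos_sub, Real.cos_add]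
    ring
  have hd : Real.cos a - Real.cos b = 2 * (Real.sin s * Real.sin r) := by
    rw [ha, hb, Real.cos_sub, Real.cos_add]
    ring
  have ht : 2 * |r| ≤ t := by
    have : |b - a| = 2 * |r| := by
      rw [show b - a = 2 * r by ring, abs_mul, abs_two]
    linarith
  have h1 : |Real.sin s| ≤ Real.sqrt
      ((1 - (Real.cos a + Real.cos b) / 2) * (1 + (Real.cos a + Real.cos b) / 2)) := by
    rw [hm]
    apply Real.abs_le_sqrt
    nlinarith [Real.sin_sq_add_cos_sq s, Real.sin_sq_add_cos_sq r,
      mul_nonneg (sq_nonneg (Real.cos s)) (sq_nonneg (Real.sin r))]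
  calc Real.cos a - Real.cos b = 2 * (Real.sin s * Real.sin r) := hd
    _ ≤ 2 * (|Real.sin s| * |Real.sin r|) := by
      rw [← abs_mul]
      linarith [le_abs_self (Real.sin s * Real.sin r)]
    _ = (2 * |Real.sin r|) * |Real.sin s| := by ring
    _ ≤ t * _ := mul_le_mul (by linarith [Real.abs_sin_le_abs (x := r)]) h1 (abs_nonneg _)
      (by linarith [abs_nonneg r])

lemma abs_sub_chebyshevPoint_update_le {d : ℕ} {f : EuclideanSpace ℝ (Fin d) → ℝ}
    (hf : ContinuousOn f (cube d)) {t : ℝ} (θ : Fin d → ℝ) (l : Fin d) {a b : ℝ}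
    (hab : |b - a| ≤ t) :
    |f (chebyshevPoint (Function.update θ l b)) - f (chebyshevPoint (Function.update θ l a))| ≤
      totikDitzianModulus (cube d) f t := by
  wlog hlt : Real.cos b ≤ Real.cos a generalizing a b
  · rw [abs_sub_comm]
    exact this (by rwa [abs_sub_comm]) (le_of_not_ge hlt)
  -- Coinciding nodes are set apart because the modulus requires `h > 0`; distinct nodes also make
  -- the normalized distance at their midpoint positive.
  rcases hlt.eq_or_lt with heq | hlt
  · have : chebyshevPoint (Function.update θ l b) = chebyshevPoint (Function.update θ l a) := by
      ext i
      by_cases hi : i = l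
      · subst hi
        simp [chebyshevPoint_apply, heq]
      · simp [chebyshevPoint_apply, hi]
    rw [this, sub_self, abs_zero]
    exact totikDitzianModulus_nonneg _ _ _
  set p := chebyshevPoint (Function.update θ l a) with hp
  set q := chebyshevPoint (Function.update θ l b) with hq
  have hpQ : p ∈ cube d := chebyshevPoint_mem_cube _
  have hqQ : q ∈ cube d := chebyshevPoint_mem_cube _
  have hpl : p l = -Real.cos a := by simp [hp, chebyshevPoint_apply]
  have hql : q l = -Real.cos b := by simp [hq, chebyshevPoint_apply]
  have hpq : ∀ i, i ≠ l → q i = p i := fun i hi => by simp [hp, hq, chebyshevPoint_apply, hi]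
  set e := EuclideanSpace.single l (1 : ℝ) with he
  set m : EuclideanSpace ℝ (Fin d) := p + ((q l - p l) / 2) • e with hm
  have hml : m l = (p l + q l) / 2 := by
    simp only [hm, he, PiLp.add_apply, PiLp.smul_apply, PiLp.single_apply, if_true,
      smul_eq_mul]
    ring
  have hmQ : m ∈ cube d := by
    refine mem_cube_of_forall_ne hpQ l (fun i hi => by simp [hm, he, hi]) ?_
    rw [hml]
    constructor <;> linarith [(hpQ l).1, (hpQ l).2, (hqQ l).1, (hqQ l).2]
  set D := normalizedDist (cube d) e m with hD
  have hDeq : D = Real.sqrt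
      ((1 - (Real.cos a + Real.cos b) / 2) * (1 + (Real.cos a + Real.cos b) / 2)) := by
    rw [hD, normalizedDist_cube_single l hmQ, hml, hpl, hql]
    congr 1
    ring
  have hDpos : 0 < D := by
    rw [hDeq]
    apply Real.sqrt_pos.2
    apply mul_pos <;>
    linarith [Real.cos_le_one a, Real.cos_le_one b, Real.neg_one_le_cos a, Real.neg_one_le_cos b]
  have hle := cos_sub_cos_le_mul_sqrt hab
  rw [← hDeq] at hle
  have hhD : (Real.cos a - Real.cos b) / D * D / 2 = (q l - p l) / 2 := by
    rw [div_mul_cancel₀ _ hDpos.ne', hpl, hql]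
    ring
  have h1 : m + ((Real.cos a - Real.cos b) / D * D / 2) • e = q := by
    rw [hhD]
    ext i
    by_cases hi : i = l
    · subst hi
      simp only [hm, he, PiLp.add_apply, PiLp.smul_apply, PiLp.single_apply, if_true, smul_eq_mul]
      ring
    · simp [hm, he, hi, hpq i hi]
  have h2 : m - ((Real.cos a - Real.cos b) / D * D / 2) • e = p := by
    rw [hhD, hm, add_sub_cancel_right]
  have := abs_sub_le_totikDitzianModulus hf (t := t) hmQ (single_mem_edgeDirections_cube l)
    (h := (Real.cos a - Real.cos b) / D) (div_pos (sub_pos.2 hlt) hDpos)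
    ((div_le_iff₀ hDpos).2 hle) (h1 ▸ hqQ) (h2 ▸ hpQ)
  rwa [h1, h2] at this

lemma abs_sub_chebyshevPoint_update_le_mul {d : ℕ} {f : EuclideanSpace ℝ (Fin d) → ℝ}
    (hf : ContinuousOn f (cube d)) {t : ℝ} (k : ℕ) (θ : Fin d → ℝ) (l : Fin d)
    {a b : ℝ} (hab : |b - a| ≤ k * t) :
    |f (chebyshevPoint (Function.update θ l b)) - f (chebyshevPoint (Function.update θ l a))| ≤
      k * totikDitzianModulus (cube d) f t := by
  induction k generalizing b with
  | zero =>
    have : b = a := by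
      rw [Nat.cast_zero, zero_mul] at hab
      linarith [abs_nonpos_iff.1 hab]
    simp [this]
  | succ k ih =>
    have hk : (0 : ℝ) < k + 1 := by positivity
    push_cast at hab ⊢
    obtain ⟨c, hc1, hc2⟩ : ∃ c, |b - c| ≤ t ∧ |c - a| ≤ k * t := by
      refine ⟨b - (b - a) / (k + 1), ?_, ?_⟩
      · rw [sub_sub_cancel, abs_div, abs_of_pos hk, div_le_iff₀ hk]
        linarith
      · rw [show b - (b - a) / (k + 1) - a = k * ((b - a) / (k + 1)) by field_simp; ring, abs_mul,
          abs_div, abs_of_pos hk, abs_of_nonneg (Nat.cast_nonneg k : (0 : ℝ) ≤ k)]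
        gcongr
        rw [div_le_iff₀ hk]
        linarith
    have h1 := abs_sub_chebyshevPoint_update_le hf θ l hc1
    have h2 := ih hc2
    have h3 := abs_sub_le (f (chebyshevPoint (Function.update θ l b)))
      (f (chebyshevPoint (Function.update θ l c))) (f (chebyshevPoint (Function.update θ l a)))
    linarith

lemma abs_sub_chebyshevPoint_le {d : ℕ} {f : EuclideanSpace ℝ (Fin d) → ℝ}
    (hf : ContinuousOn f (cube d)) {t : ℝ} (k : ℕ) (θ θ' : Fin d → ℝ)
    (h : ∀ i, |θ i - θ' i| ≤ k * t) :
    |f (chebyshevPoint θ) - f (chebyshevPoint θ')| ≤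
      d * (k * totikDitzianModulus (cube d) f t) := by
  -- The angles are exchanged one coordinate at a time.
  have key : ∀ s : Finset (Fin d), |f (chebyshevPoint (s.piecewise θ θ')) -
      f (chebyshevPoint θ')| ≤ s.card * (k * totikDitzianModulus (cube d) f t) := by
    intro s
    induction s using Finset.induction_on with
    | empty => simp
    | insert a s ha ih =>
      have h1 := abs_sub_chebyshevPoint_update_le_mul hf k (s.piecewise θ θ') a (h a)
      have h2 : Function.update (s.piecewise θ θ') a (θ' a) = s.piecewise θ θ' := by
        rw [← Finset.piecewise_eq_of_notMem s θ θ' ha, Function.update_eq_self]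
      rw [← Finset.piecewise_insert, h2] at h1
      have h3 := abs_sub_le (f (chebyshevPoint ((insert a s).piecewise θ θ')))
        (f (chebyshevPoint (s.piecewise θ θ'))) (f (chebyshevPoint θ'))
      rw [Finset.card_insert_of_notMem ha]
      push_cast
      linarith
  simpa using key Finset.univ

/-! ### Chebyshev knots and their cells -/

/-- The Chebyshev knots `-cos (k π / M)`, increasing in `k ≤ M` from `-1` to `1`. -/
noncomputable def knot (M k : ℕ) : ℝ := -Real.cos (k * Real.pi / M)

lemma knot_angle_mem {M k : ℕ} (hk : k ≤ M) : k * Real.pi / M ∈ Set.Icc 0 Real.pi := by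
  refine ⟨by positivity, ?_⟩
  have hkM : (k : ℝ) ≤ M := by exact_mod_cast hk
  exact div_le_of_le_mul₀ (by positivity) Real.pi_pos.le
    (by nlinarith [Real.pi_pos])

lemma knot_le_knot {M i j : ℕ} (hij : i ≤ j) (hj : j ≤ M) : knot M i ≤ knot M j := by
  have h : (i : ℝ) ≤ j := by exact_mod_cast hij
  refine neg_le_neg (Real.strictAntiOn_cos.antitoneOn (knot_angle_mem (hij.trans hj))
    (knot_angle_mem hj) ?_)
  gcongr

lemma knot_lt_knot {M i j : ℕ} (hij : i < j) (hj : j ≤ M) : knot M i < knot M j := by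
  have h : (i : ℝ) < j := by exact_mod_cast hij
  have hM : (0 : ℝ) < M := by exact_mod_cast (Nat.zero_le i).trans_lt (hij.trans_le hj)
  refine neg_lt_neg (Real.strictAntiOn_cos (knot_angle_mem (hij.le.trans hj))
    (knot_angle_mem hj) ?_)
  have := Real.pi_pos
  gcongr

lemma exists_knot_gap {M : ℕ} (hM : 1 ≤ M) :
    ∃ η : ℝ, 0 < η ∧ ∀ k < M, knot M k + η ≤ knot M (k + 1) := by
  obtain ⟨i, hi, h⟩ := (Finset.range M).exists_min_image (fun k => knot M (k + 1) - knot M k)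
    ⟨0, Finset.mem_range.2 hM⟩
  rw [Finset.mem_range] at hi
  refine ⟨knot M (i + 1) - knot M i, sub_pos.2 (knot_lt_knot i.lt_succ_self hi), fun k hk => ?_⟩
  linarith [h k (Finset.mem_range.2 hk)]

lemma exists_angle_mem_cell {M : ℕ} (hM : 1 ≤ M) {θ : ℝ} (hθ : θ ∈ Set.Icc 0 Real.pi) :
    ∃ k : ℕ, k < M ∧ k * Real.pi / M ≤ θ ∧ θ ≤ (k + 1 : ℕ) * Real.pi / M := by
  have hM0 : (0 : ℝ) < M := by exact_mod_cast hM
  have hpi := Real.pi_pos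
  rcases hθ.2.eq_or_lt with rfl | hlt
  · refine ⟨M - 1, by omega, (knot_angle_mem (by omega)).2, ?_⟩
    rw [Nat.sub_add_cancel hM, mul_div_cancel_left₀ _ hM0.ne']
  · have h0 : 0 ≤ θ * M / Real.pi := div_nonneg (mul_nonneg hθ.1 hM0.le) hpi.le
    refine ⟨⌊θ * M / Real.pi⌋₊, ?_, ?_, ?_⟩
    · rw [Nat.floor_lt h0, div_lt_iff₀ hpi]
      nlinarith
    · rw [div_le_iff₀ hM0, ← le_div_iff₀ hpi]
      exact Nat.floor_le h0
    · rw [le_div_iff₀ hM0, ← div_le_iff₀ hpi]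
      push_cast
      exact (Nat.lt_floor_add_one _).le

/-- A point less than one gap outside cell `k` has not passed the next knot on either side. The
angle is compared with the left end of the cell, so the bound is one cell to the left and two to the
right. -/
lemma abs_angle_sub_le_of_near_cell {M k : ℕ} (hk : k < M) {η : ℝ}
    (hη : ∀ k < M, knot M k + η ≤ knot M (k + 1)) {θ : ℝ} (hθ : θ ∈ Set.Icc 0 Real.pi)
    (h1 : knot M k - -Real.cos θ < η) (h2 : -Real.cos θ - knot M (k + 1) < η) :
    |k * Real.pi / M - θ| ≤ 2 * Real.pi / M := by
  have hM0 : (0 : ℝ) < M := by exact_mod_cast (Nat.zero_le k).trans_lt hk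
  have hpi := Real.pi_pos
  have hlo : (k : ℝ) * Real.pi / M - Real.pi / M ≤ θ := by
    rcases k with _ | k
    · have : 0 < Real.pi / M := by positivity
      simp only [Nat.cast_zero, zero_mul, zero_div]
      linarith [hθ.1]
    · have hlt : Real.cos θ < Real.cos (k * Real.pi / M) := by
        have := hη k (by omega)
        unfold knot at *
        linarith
      have := (Real.strictAntiOn_cos.lt_iff_gt hθ (knot_angle_mem (by omega))).1 hlt
      push_cast
      calc (k + 1) * Real.pi / M - Real.pi / M = k * Real.pi / M := by ring
        _ ≤ θ := this.le
  have hhi : θ ≤ (k : ℝ) * Real.pi / M + 2 * Real.pi / M := by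
    rw [← add_div, ← add_mul]
    rcases lt_or_ge (k + 1) M with hk1 | hk1
    · have hlt : Real.cos ((k + 1 + 1 : ℕ) * Real.pi / M) < Real.cos θ := by
        have := hη (k + 1) hk1
        unfold knot at *
        linarith
      have := (Real.strictAntiOn_cos.lt_iff_gt (knot_angle_mem (by omega)) hθ).1 hlt
      push_cast at this
      calc θ ≤ (k + 1 + 1) * Real.pi / M := this.le
        _ = (k + 2) * Real.pi / M := by ring
    · refine hθ.2.trans ?_
      rw [le_div_iff₀ hM0]
      have : (M : ℝ) ≤ k + 1 := by exact_mod_cast hk1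
      nlinarith
  have : 0 < Real.pi / M := by positivity
  rw [abs_le]
  constructor
  · linarith
  · rw [mul_div_assoc 2]
    linarith

/-! ### Penalized interpolants and their maximum -/

/-- The piecewise linear function with values `F k` at the knots `knot M k`, in ReLU form. -/
noncomputable def knotInterpolant (M : ℕ) (F : ℕ → ℝ) (x : ℝ) : ℝ :=
  F 0 + ∑ k : Fin M, (F (k + 1) - F k) / (knot M (k + 1) - knot M k) *
    (max 0 (x - knot M k) - max 0 (x - knot M (k + 1)))

/-- Terms of cells to the left telescope to `F k` and those to the right vanish, which leaves a
convex combination of `F k` and `F (k + 1)`. -/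
lemma knotInterpolant_mem_Icc {M k : ℕ} (hk : k < M) {F : ℕ → ℝ} {x a b : ℝ}
    (hx : x ∈ Set.Icc (knot M k) (knot M (k + 1))) (h0 : F k ∈ Set.Icc a b)
    (h1 : F (k + 1) ∈ Set.Icc a b) : knotInterpolant M F x ∈ Set.Icc a b := by
  set g : ℕ → ℝ := fun k => (F (k + 1) - F k) / (knot M (k + 1) - knot M k) *
    (max 0 (x - knot M k) - max 0 (x - knot M (k + 1))) with hg
  have hlow : ∀ m ≤ k, F 0 + ∑ i ∈ Finset.range m, g i = F m := by
    intro m hm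
    induction m with
    | zero => simp
    | succ m ih =>
      have hm1 : knot M m < knot M (m + 1) := knot_lt_knot m.lt_succ_self (by omega)
      have hm2 : knot M (m + 1) ≤ x := (knot_le_knot hm hk.le).trans hx.1
      have hgm : g m = F (m + 1) - F m := by
        simp only [hg]
        rw [max_eq_right (by linarith), max_eq_right (by linarith), sub_sub_sub_cancel_left,
          div_mul_cancel₀ _ (sub_pos.2 hm1).ne']
      rw [Finset.sum_range_succ, ← add_assoc, ih (by omega), hgm]
      ring
  have hsum : ∑ i : Fin M, g i = ∑ i ∈ Finset.range (k + 1), g i := by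
    rw [← Finset.sum_range]
    symm
    refine Finset.sum_subset (Finset.range_subset_range.2 hk) fun i hi hik => ?_
    rw [Finset.mem_range] at hi hik
    have h2 : x ≤ knot M i := hx.2.trans (knot_le_knot (by omega) hi.le)
    have h3 : x ≤ knot M (i + 1) := hx.2.trans (knot_le_knot (by omega) hi)
    simp only [hg]
    rw [max_eq_left (by linarith), max_eq_left (by linarith), sub_self, mul_zero]
  have hgap : 0 < knot M (k + 1) - knot M k := sub_pos.2 (knot_lt_knot k.lt_succ_self hk)
  have hval : knotInterpolant M F x =
      F k + (F (k + 1) - F k) * ((x - knot M k) / (knot M (k + 1) - knot M k)) := by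
    rw [knotInterpolant, hsum, Finset.sum_range_succ, ← add_assoc, hlow k le_rfl]
    simp only [hg]
    rw [max_eq_right (sub_nonneg.2 hx.1), max_eq_left (sub_nonpos.2 hx.2)]
    ring
  have hr0 : 0 ≤ (x - knot M k) / (knot M (k + 1) - knot M k) :=
    div_nonneg (sub_nonneg.2 hx.1) hgap.le
  have hr1 : (x - knot M k) / (knot M (k + 1) - knot M k) ≤ 1 := by
    rw [div_le_one hgap]
    linarith [hx.2]
  rw [hval]
  obtain ⟨h0a, h0b⟩ := h0
  obtain ⟨h1a, h1b⟩ := h1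
  constructor <;> nlinarith

/-- `K` times the `ℓ¹`-distance from the last `n` coordinates of `x` to the grid cell `j`. -/
noncomputable def cellPenalty {n : ℕ} (M : ℕ) (K : ℝ) (j : Fin n → Fin M)
    (x : Fin (n + 1) → ℝ) : ℝ :=
  K * ∑ l, (max 0 (knot M (j l) - x l.succ) + max 0 (x l.succ - knot M (j l + 1)))

/-- The maximum over all cells of the penalized interpolants. -/
noncomputable def cellMax {n : ℕ} (M : ℕ) (K : ℝ) (F : (Fin n → Fin M) → ℕ → ℝ)
    (x : Fin (n + 1) → ℝ) : ℝ :=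
  ⨆ j : Fin n → Fin M, max 0 (knotInterpolant M (F j) (x 0) - cellPenalty M K j x)

/-- The grid point in column `j` of cells with index `k` in the first coordinate. -/
noncomputable def gridPoint {n : ℕ} (M : ℕ) (j : Fin n → Fin M) (k : ℕ) :
    EuclideanSpace ℝ (Fin (n + 1)) :=
  chebyshevPoint (Fin.cons (k * Real.pi / M) fun l => j l * Real.pi / M)

/-- Interpolants lie in `[0, 2B]`, so `2 * B ≤ K * η` makes a cell at distance at least `η` in some
coordinate contribute nothing positive. A cell nearer than that in every coordinate has its corner
within `2π / M` of the angles of `x`, hence within seven steps of size `t`. -/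
lemma cellMax_approx {n M : ℕ} (hM : 1 ≤ M) {f : EuclideanSpace ℝ (Fin (n + 1)) → ℝ}
    (hf : ContinuousOn f (cube (n + 1))) {t : ℝ} (ht : 2 * Real.pi / M ≤ 7 * t) {B K η : ℝ}
    (hB : ∀ x ∈ cube (n + 1), |f x| ≤ B)
    (hη : ∀ k < M, knot M k + η ≤ knot M (k + 1)) (hK0 : 0 ≤ K) (hK : 2 * B ≤ K * η)
    {x : EuclideanSpace ℝ (Fin (n + 1))} (hx : x ∈ cube (n + 1)) :
    |-B + cellMax M K (fun j k => f (gridPoint M j k) + B) x| ≤ B ∧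
    |-B + cellMax M K (fun j k => f (gridPoint M j k) + B) x - f x| ≤
      (n + 1) * (7 * totikDitzianModulus (cube (n + 1)) f t) := by
  have hpi := Real.pi_pos
  have hM0 : (0 : ℝ) < M := by exact_mod_cast hM
  have hpiM : 0 < Real.pi / M := by positivity
  set E := (n + 1) * (7 * totikDitzianModulus (cube (n + 1)) f t) with hE
  have hE0 : 0 ≤ E := by
    have := totikDitzianModulus_nonneg (cube (n + 1)) f t
    positivity
  obtain ⟨θ, hθ, hxθ⟩ : ∃ θ : Fin (n + 1) → ℝ, (∀ i, θ i ∈ Set.Icc 0 Real.pi) ∧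
      ∀ i, x i = -Real.cos (θ i) := by
    refine ⟨fun i => Real.arccos (-x i), fun i => ⟨Real.arccos_nonneg _, Real.arccos_le_pi _⟩,
      fun i => ?_⟩
    rw [Real.cos_arccos (by linarith [(hx i).2]) (by linarith [(hx i).1]), neg_neg]
  have hxeq : x = chebyshevPoint θ := by
    ext i
    exact hxθ i
  choose k hkM hk1 hk2 using fun i => exists_angle_mem_cell hM (hθ i)
  have hxk : ∀ i, x i ∈ Set.Icc (knot M (k i)) (knot M (k i + 1)) := fun i => by
    rw [hxθ]
    exact ⟨neg_le_neg (Real.strictAntiOn_cos.antitoneOn (knot_angle_mem (hkM i).le) (hθ i) (hk1 i)),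
      neg_le_neg (Real.strictAntiOn_cos.antitoneOn (hθ i) (knot_angle_mem (hkM i)) (hk2 i))⟩
  have hfx := abs_le.1 (hB x hx)
  set F : (Fin n → Fin M) → ℕ → ℝ := fun j k => f (gridPoint M j k) + B with hF
  have hbound : ∀ j, knotInterpolant M (F j) (x 0) ∈ Set.Icc 0 (2 * B) := by
    have hval : ∀ j k, F j k ∈ Set.Icc 0 (2 * B) := fun j k => by
      have := abs_le.1 (hB (gridPoint M j k) (chebyshevPoint_mem_cube _))
      constructor <;> simp only [hF] <;> linarith
    exact fun j => knotInterpolant_mem_Icc (hkM 0) (hxk 0) (hval j _) (hval j _)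
  have hnear : ∀ j : Fin n → Fin M, (∀ l, |j l * Real.pi / M - θ l.succ| ≤ 2 * Real.pi / M) →
      knotInterpolant M (F j) (x 0) ∈ Set.Icc (f x + B - E) (f x + B + E) := by
    intro j hj
    have hval : ∀ i : ℕ, |i * Real.pi / M - θ 0| ≤ 2 * Real.pi / M →
        F j i ∈ Set.Icc (f x + B - E) (f x + B + E) := by
      intro i hi
      have := abs_sub_chebyshevPoint_le hf (t := t) 7
        (Fin.cons (i * Real.pi / M) fun l => j l * Real.pi / M) θ (by
          refine Fin.cases ?_ fun l => ?_
          · simpa using hi.trans ht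
          · simpa using (hj l).trans ht)
      rw [← hxeq] at this
      push_cast at this
      have := abs_le.1 this
      constructor <;> simp only [hF, gridPoint] <;> linarith
    have h1 := hk1 0
    have h2 := hk2 0
    push_cast at h2
    rw [add_mul, one_mul, add_div] at h2
    refine knotInterpolant_mem_Icc (hkM 0) (hxk 0) (hval _ ?_) (hval _ ?_)
    · rw [abs_le, mul_div_assoc 2]
      constructor <;> linarith
    · push_cast
      rw [abs_le, mul_div_assoc 2, add_mul, one_mul, add_div]
      constructor <;> linarith
  have hpen : ∀ j, 0 ≤ cellPenalty M K j x := fun j =>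
    mul_nonneg hK0 (Finset.sum_nonneg fun l _ =>
      add_nonneg (le_max_left _ _) (le_max_left _ _))
  have hle_penalty : ∀ (j : Fin n → Fin M) (l : Fin n),
      K * (max 0 (knot M (j l) - x l.succ) + max 0 (x l.succ - knot M (j l + 1))) ≤
        cellPenalty M K j x := fun j l =>
    mul_le_mul_of_nonneg_left (Finset.single_le_sum (f := fun l =>
      max 0 (knot M (j l) - x l.succ) + max 0 (x l.succ - knot M (j l + 1)))
      (fun l _ => add_nonneg (le_max_left _ _) (le_max_left _ _)) (Finset.mem_univ l)) hK0
  have hfar : ∀ (j : Fin n → Fin M) (l : Fin n),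
      η ≤ max 0 (knot M (j l) - x l.succ) + max 0 (x l.succ - knot M (j l + 1)) →
      knotInterpolant M (F j) (x 0) - cellPenalty M K j x ≤ 0 := by
    intro j l h
    linarith [(hbound j).2, hle_penalty j l, mul_le_mul_of_nonneg_left h hK0]
  have : Nonempty (Fin n → Fin M) := ⟨fun _ => ⟨0, hM⟩⟩
  have hupper : cellMax M K F x ≤ f x + B + E := by
    refine ciSup_le fun j => max_le (by linarith) ?_
    by_cases h : ∃ l, η ≤ max 0 (knot M (j l) - x l.succ) + max 0 (x l.succ - knot M (j l + 1))
    · obtain ⟨l, hl⟩ := h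
      linarith [hfar j l hl]
    · push Not at h
      have := hnear j fun l => by
        have h1 := h l
        refine abs_angle_sub_le_of_near_cell (j l).2 hη (hθ l.succ) ?_ ?_ <;>
        rw [← hxθ] <;>
        linarith [le_max_left 0 (knot M (j l) - x l.succ), le_max_right 0 (knot M (j l) - x l.succ),
          le_max_left 0 (x l.succ - knot M (j l + 1)), le_max_right 0 (x l.succ - knot M (j l + 1))]
      linarith [this.2, hpen j]
  have hupper' : cellMax M K F x ≤ 2 * B :=
    ciSup_le fun j => max_le (by linarith) (by linarith [(hbound j).2, hpen j])
  have hlower : ∀ j, knotInterpolant M (F j) (x 0) - cellPenalty M K j x ≤ cellMax M K F x ∧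
      0 ≤ cellMax M K F x := fun j => by
    have := le_ciSup (f := fun j => max 0 (knotInterpolant M (F j) (x 0) - cellPenalty M K j x))
      (Finite.bddAbove_range _) j
    exact ⟨(le_max_right _ _).trans this, (le_max_left _ _).trans this⟩
  -- The cell containing `x` carries no penalty and gives the lower bound.
  let j₀ : Fin n → Fin M := fun l => ⟨k l.succ, hkM _⟩
  have hpen0 : cellPenalty M K j₀ x = 0 := by
    rw [cellPenalty, Finset.sum_eq_zero, mul_zero]
    intro l _
    have h := hxk l.succ
    rw [max_eq_left (sub_nonpos.2 h.1), max_eq_left (sub_nonpos.2 h.2), add_zero]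
  have h1 := hnear j₀ fun l => by
    have h1 := hk1 l.succ
    have h2 := hk2 l.succ
    push_cast at h2
    rw [add_mul, one_mul, add_div] at h2
    rw [abs_le, mul_div_assoc 2]
    constructor <;> simp only [j₀] <;> linarith
  have h2 := hlower j₀
  rw [hpen0, sub_zero] at h2
  refine ⟨abs_le.2 ⟨by linarith [h2.2], by linarith⟩, abs_le.2 ⟨by linarith [h1.1], by linarith⟩⟩

/-! ### The cutoff level -/

/-- A function that is `B` on `[-1 + δ, 1 - δ]^d` and nonpositive outside `[-1, 1]^d`. -/
noncomputable def cutoff {d : ℕ} (B δ : ℝ) (x : Fin d → ℝ) : ℝ :=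
  B - B / δ * ∑ i, (max 0 (x i - (1 - δ)) + max 0 (-1 + δ - x i))

lemma cutoff_of_mem_shrunkCube {d : ℕ} (B : ℝ) {δ : ℝ} {x : EuclideanSpace ℝ (Fin d)}
    (hx : x ∈ shrunkCube d δ) : cutoff B δ x = B := by
  rw [cutoff, Finset.sum_eq_zero, mul_zero, sub_zero]
  intro i _
  rw [max_eq_left (by linarith [(hx i).2]), max_eq_left (by linarith [(hx i).1]), add_zero]

lemma cutoff_nonpos_of_notMem_cube {d : ℕ} {B δ : ℝ} (hB : 0 ≤ B) (hδ : 0 < δ)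
    {x : EuclideanSpace ℝ (Fin d)} (hx : x ∉ cube d) : cutoff B δ x ≤ 0 := by
  obtain ⟨i, hi⟩ : ∃ i, x i ∉ Set.Icc (-1 : ℝ) 1 := by
    by_contra! h
    exact hx h
  have h1 : δ ≤ max 0 (x i - (1 - δ)) + max 0 (-1 + δ - x i) := by
    rw [Set.mem_Icc, not_and_or, not_le, not_le] at hi
    rcases hi with hi | hi
    · linarith [le_max_left 0 (x i - (1 - δ)), le_max_right 0 (-1 + δ - x i)]
    · linarith [le_max_right 0 (x i - (1 - δ)), le_max_left 0 (-1 + δ - x i)]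
  have h2 := h1.trans (Finset.single_le_sum
    (f := fun i => max 0 (x i - (1 - δ)) + max 0 (-1 + δ - x i))
    (fun i _ => add_nonneg (le_max_left _ _) (le_max_left _ _)) (Finset.mem_univ i))
  have h3 := mul_le_mul_of_nonneg_left h2 (div_nonneg hB hδ.le)
  rw [div_mul_cancel₀ _ hδ.ne'] at h3
  rw [cutoff]
  linarith

/-! ### Assembly of the network -/

lemma exists_network_truncate_cellMax (n : ℕ) {m M : ℕ} (hM : M = 2 ^ m)
    (F : (Fin n → Fin M) → ℕ → ℝ) (K B c δ : ℝ) :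
    ∃ φ : ReLUNetwork (n + 1),
      φ.width ≤ max (2 ^ (m * n + 1) + 1) ((n + 1) * ((M + 1) * 2) + (n + 1) * 2) ∧
      φ.depth ≤ m * n + 3 ∧
      ∀ x : Fin (n + 1) → ℝ, φ.eval x =
        truncate (c + cellMax M K F x) (max 0 (cutoff B δ x)) := by
  -- As `M` is a power of two, bit strings of length `m * n` enumerate the cells exactly.
  let s : (Fin (m * n) → Bool) ≃ (Fin n → Fin M) :=
    Fintype.equivOfCardEq (by simp [hM, pow_mul])
  let ι := (Fin (n + 1) × Fin (M + 1) × Bool) ⊕ (Fin (n + 1) × Bool)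
  let H₁ : ι → (Fin (n + 1) → ℝ) → ℝ := fun a x =>
    match a with
    | .inl (i, k, false) => x i - knot M k
    | .inl (i, k, true) => knot M k - x i
    | .inr (i, false) => x i - (1 - δ)
    | .inr (i, true) => -1 + δ - x i
  have hH₁ : ∀ a, IsAffineFun (H₁ a) := by
    rintro (⟨i, k, _ | _⟩ | ⟨i, _ | _⟩)
    · exact (IsAffineFun.coord i).sub (.const _)
    · exact (IsAffineFun.const _).sub (.coord i)
    · exact (IsAffineFun.coord i).sub (.const _)
    · exact (IsAffineFun.const _).sub (.coord i)
  let H₂ : MaxTreeIndex (m * n) → (ι → ℝ) → ℝ := fun a y =>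
    match a with
    | .inl (p, false) =>
      (F (s p) 0 + ∑ k : Fin M, (F (s p) (k + 1) - F (s p) k) / (knot M (k + 1) - knot M k) *
        (y (.inl (0, k.castSucc, false)) - y (.inl (0, k.succ, false)))) -
      K * ∑ l, (y (.inl (l.succ, (s p l).castSucc, true)) +
        y (.inl (l.succ, (s p l).succ, false)))
    -- Each candidate enters the tree as a single ReLU; its second neuron stays idle.
    | .inl (_, true) => 0
    | .inr () => B - B / δ * ∑ i, (y (.inr (i, false)) + y (.inr (i, true)))
  have hH₂ : ∀ a, IsAffineFun (H₂ a) := by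
    rintro (⟨p, _ | _⟩ | _)
    · exact ((IsAffineFun.const _).add (.sum _ fun k => .const_mul _
        ((IsAffineFun.coord _).sub (.coord _)))).sub
        (.const_mul _ (.sum _ fun l => (IsAffineFun.coord _).add (.coord _)))
    · exact .const 0
    · exact (IsAffineFun.const _).sub
        (.const_mul _ (.sum _ fun l => (IsAffineFun.coord _).add (.coord _)))
  set w := max (2 ^ (m * n + 1) + 1) ((n + 1) * ((M + 1) * 2) + (n + 1) * 2) with hw
  have htree := (realizesNonneg_maxTree c (m * n)).mono (w' := w) (le_max_left _ _) le_rfl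
    fun y _ => rfl
  obtain ⟨φ, h1, h2, h3⟩ := (htree.hidden (by simp [hw, pow_succ]) hH₂).exists_hidden
    (by simp [hw, ι]) hH₁ (Equiv.refl _)
  refine ⟨φ, h1, h2, fun x => (h3 x).trans ?_⟩
  have hsup : cellMax M K F x = ⨆ p, max 0 (knotInterpolant M (F (s p)) (x 0) -
      cellPenalty M K (s p) x) :=
    (s.surjective.iSup_comp fun j =>
      max 0 (knotInterpolant M (F j) (x 0) - cellPenalty M K j x)).symm
  rw [hsup]
  simp [H₁, H₂, knotInterpolant, cellPenalty, cutoff]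

/-! ### Size and error bounds -/

/-- At `N = 1` the logarithm vanishes and `N ^ 3` dominates; from `N = 2` on, `log N ≥ 1/2`. -/
lemma natCast_pow_le_max {N : ℕ} (hN : 1 ≤ N) (n : ℕ) :
    (N : ℝ) ^ n ≤ 2 * max ((N : ℝ) ^ 3) ((N : ℝ) ^ n * Real.log N) := by
  rcases hN.eq_or_lt with rfl | hN
  · simp
  · have h2 : (2 : ℝ) ≤ N := by exact_mod_cast hN
    have hlog : 1 / 2 ≤ Real.log N := by
      have := Real.log_le_log (by norm_num) h2
      linarith [Real.log_two_gt_d9]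
    have := le_max_right ((N : ℝ) ^ 3) ((N : ℝ) ^ n * Real.log N)
    have hp : 0 ≤ (N : ℝ) ^ n := by positivity
    nlinarith

theorem mainTheorem4 (d : ℕ) (hd : 1 ≤ d) (α : ℝ) (hα : 0 < α) :
    ∃ C : ℝ, 0 < C ∧
      ∀ f : EuclideanSpace ℝ (Fin d) → ℝ, ContinuousOn f (cube d) →
      ∀ N : ℕ, 1 ≤ N →
      ∀ δ : ℝ, 0 < δ → δ < 1 →
      ∃ φ : ReLUNetwork d,
        (φ.width : ℝ) ≤ C * max ((N : ℝ) ^ 3) ((N : ℝ) ^ (d - 1) * Real.log (N : ℝ)) ∧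
        (φ.depth : ℝ) ≤ C * (1 + Real.log (N : ℝ)) ∧
        Function.support φ.toFun ⊆ cube d ∧
        ∀ x ∈ shrunkCube d δ,
          |φ.toFun x - f x| ≤
            C * (totikDitzianModulus (cube d) f (1 / (N : ℝ)) + (N : ℝ) ^ (-α)) := by
  obtain ⟨n, rfl⟩ : ∃ n, d = n + 1 := ⟨d - 1, by omega⟩
  rw [Nat.add_sub_cancel]
  -- The first summand covers the first-layer width and the error `7 * (n + 1)`, the second the tree
  -- width.
  refine ⟨10 * (n + 1) + 6 * 2 ^ n, by positivity, fun f hf N hN δ hδ0 hδ1 => ?_⟩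
  have hN1 : (1 : ℝ) ≤ N := by exact_mod_cast hN
  have hN0 : (0 : ℝ) < N := by linarith
  have hlogN : 0 ≤ Real.log N := Real.log_nonneg hN1
  -- The lower bound on `2 ^ m` makes the mesh fine enough; the upper bound limits the network size.
  obtain ⟨m, hNm, hmN⟩ : ∃ m : ℕ, N ≤ 2 ^ m ∧ 2 ^ m ≤ 2 * N := by
    refine ⟨Nat.log 2 N + 1, (Nat.lt_pow_succ_log_self (by norm_num) N).le, ?_⟩
    rw [pow_succ, mul_comm]
    exact Nat.mul_le_mul_left 2 (Nat.pow_log_le_self 2 (by omega))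
  have hmN' : (2 : ℝ) ^ m ≤ 2 * N := by exact_mod_cast hmN
  have hM : 1 ≤ 2 ^ m := Nat.one_le_two_pow
  obtain ⟨B, hB0, hB⟩ := exists_abs_le_of_continuousOn_cube hf
  obtain ⟨η, hη0, hη⟩ := exists_knot_gap hM
  obtain ⟨φ, hwidth, hdepth, heval⟩ := exists_network_truncate_cellMax n (m := m) rfl
    (fun j k => f (gridPoint (2 ^ m) j k) + B) (2 * B / η) B (-B) δ
  have hC1 : (1 : ℝ) ≤ 2 ^ n := one_le_pow₀ (by norm_num)
  have hn0 : (0 : ℝ) ≤ n := n.cast_nonneg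
  refine ⟨φ, ?_, ?_, fun x hx => ?_, fun x hx => ?_⟩
  · have hmax := natCast_pow_le_max hN n
    set X := max ((N : ℝ) ^ 3) ((N : ℝ) ^ n * Real.log N)
    have hX1 : (N : ℝ) ≤ X := le_trans (le_self_pow₀ hN1 (by norm_num)) (le_max_left _ _)
    have h1 : (2 : ℝ) ^ (m * n + 1) + 1 ≤ 6 * 2 ^ n * X := by
      have h2 : (2 : ℝ) ^ (m * n) ≤ 2 ^ n * (N : ℝ) ^ n := by
        rw [pow_mul, ← mul_pow]
        exact pow_le_pow_left₀ (by positivity) hmN' n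
      have h3 : (1 : ℝ) ≤ 2 ^ n * (N : ℝ) ^ n := one_le_mul_of_one_le_of_one_le hC1 (one_le_pow₀ hN1)
      rw [pow_succ]
      nlinarith
    have h2 : ((n : ℝ) + 1) * ((2 ^ m + 1) * 2) + (n + 1) * 2 ≤ 10 * (n + 1) * X := by
      nlinarith
    calc (φ.width : ℝ) ≤ max ((2 : ℝ) ^ (m * n + 1) + 1)
          (((n : ℝ) + 1) * ((2 ^ m + 1) * 2) + (n + 1) * 2) := by exact_mod_cast hwidth
      _ ≤ (10 * (n + 1) + 6 * 2 ^ n) * X := by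
        refine max_le (h1.trans ?_) (h2.trans ?_) <;>
        exact mul_le_mul_of_nonneg_right (by linarith) (by linarith)
  · have hm : (m : ℝ) ≤ 2 * (1 + Real.log N) := by
      have h1 := Real.log_le_log (by positivity) hmN'
      rw [Real.log_pow, Real.log_mul (by norm_num) hN0.ne'] at h1
      nlinarith [Real.log_two_gt_d9, Real.log_two_lt_d9, (m.cast_nonneg : (0 : ℝ) ≤ m)]
    calc (φ.depth : ℝ) ≤ m * n + 3 := by exact_mod_cast hdepth
      _ ≤ 2 * (1 + Real.log N) * n + 3 := by gcongr
      _ ≤ (10 * (n + 1) + 6 * 2 ^ n) * (1 + Real.log N) := by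
        nlinarith [mul_nonneg hn0 hlogN, mul_nonneg (by linarith : (0 : ℝ) ≤ 2 ^ n) hlogN]
  · by_contra hxQ
    refine hx ?_
    rw [ReLUNetwork.toFun, heval, max_eq_left (cutoff_nonpos_of_notMem_cube hB0 hδ0 hxQ),
      truncate_zero]
  · have hxQ : x ∈ cube (n + 1) := fun i =>
      ⟨by linarith [(hx i).1], by linarith [(hx i).2]⟩
    -- The factor `7` is an integer above `2π`.
    have hang : 2 * Real.pi / (2 ^ m : ℕ) ≤ 7 * (1 / (N : ℝ)) := by
      rw [mul_one_div]
      have : (N : ℝ) ≤ (2 ^ m : ℕ) := by exact_mod_cast hNm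
      exact div_le_div₀ (by norm_num) (by linarith [Real.pi_lt_d2]) hN0 this
    obtain ⟨h1, h2⟩ := cellMax_approx hM hf hang hB hη
      (div_nonneg (by linarith) hη0.le) (div_mul_cancel₀ _ hη0.ne').ge hxQ
    rw [ReLUNetwork.toFun, heval, cutoff_of_mem_shrunkCube B hx, max_eq_right hB0,
      truncate_of_abs_le h1]
    refine h2.trans ?_
    have hω := totikDitzianModulus_nonneg (cube (n + 1)) f (1 / N)
    have hα' : 0 ≤ (N : ℝ) ^ (-α) := by positivity
    rw [← mul_assoc]
    refine mul_le_mul ?_ (by linarith) hω (by positivity)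
    linarith
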